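/- For a compact Hausdorff space $K$, let $C(K)$ be the space of real-valued continuous functions on $K$. A finite Borel measure $\mu$ on $K$ is called strictly positive if $\int f\,\mathrm{d}\mu>0$ for every $f\in C(K)$ with $f\neq 0$ and $f(x)\ge 0$ for all $x\in K$. Put $$\Delta(K,\mu)^\circ:=\Big\{f\in C(K): f(x)>0\text{ for all }x\in K\text{ and }\int f\,\mathrm{d}\mu=1\Big\}.$$ This is a convex set which meets the straight line through any two of its distinct points in an open bounded segment. For $x\neq y$ in a convex set $\Omega$ with this property, Hilbert's metric is $$\delta_H(x,y)=\log\left(\frac{|x'-y|}{|x'-x|}\,\frac{|y'-x|}{|y'-y|}\right),$$ where $x',y'$ are the end-points of the segment cut out by $\Omega$ on the line through $x$ and $y$, with $x$ between $x'$ and $y$, and $y$ between $x$ and $y'$; and $\delta_H(x,x)=0$. **Theorem.** (1) Let $K_1,K_2$ be compact Hausdorff spaces with strictly positive finite Borel measures $\mu_1,\mu_2$, respectively. A map $h\colon\Delta(K_1,\mu_1)^\circ\to\Delta(K_2,\mu_2)^\circ$ is a surjective isometry for Hilbert's metrics if and only if there exist $\varepsilon\in\{-1,1\}$, a homeomorphism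 $\theta\colon K_2\to K_1$ and $g\in C(K_2)$ with $g(x)>0$ for all $x\in K_2$ such that $$h(f)=\frac{g\cdot(f\circ\theta)^\varepsilon}{\int g\cdot(f\circ\theta)^\varepsilon\,\mathrm{d}\mu_2}\qquad\text{for all } f\in\Delta(K_1,\mu_1)^\circ .$$ (2) Let $K$ be a compact Hausdorff space with at least three points and let $\mu$ be a strictly positive finite Borel measure on $K$. Then the group of surjective isometries of $(\Delta(K,\mu)^\circ,\delta_H)$ onto itself, under composition, satisfies $$\mathrm{Isom}(\Delta(K,\mu)^\circ,\delta_H)\;\cong\;\big(C(K)/\mathbb{R}\mathbf 1\big)\rtimes\big(C_2\times\mathrm{Homeo}(K)\big),$$ where $C(K)/\mathbb{R}\mathbf 1$ is the additive group of $C(K)$ modulo the constant functions, $C_2=\{1,-1\}$ is the cyclic group of order $2$, $\mathrm{Homeo}(K)$ is the group of homeomorphisms of $K$ under composition, and $(\varepsilon,\theta)$ acts by $\overline f\mapsto\overline{\varepsilon\,(f\circ\theta^{-1})}$. -/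

import Mathlib

open MeasureTheory

namespace HilbertGeometry

noncomputable section

/-- The cross-ratio `[x', x, y, y'] = (|x' - y| / |x' - x|) * (|y' - x| / |y' - y|)`. It is only
used for collinear points; there the ratios of lengths do not depend on the norm. -/
def crossRatio {E : Type*} [NormedAddCommGroup E] (x' x y y' : E) : ℝ :=
  ‖x' - y‖ / ‖x' - x‖ * (‖y' - x‖ / ‖y' - y‖)

/-- The set of parameters `t` such that the point `x + t (y - x)` of the line through `x` and `y`
belongs to `Ω`. -/
def lineParams {E : Type*} [NormedAddCommGroup E] [NormedSpace ℝ E] (Ω : Set E) (x y : E) :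
    Set ℝ :=
  {t : ℝ | AffineMap.lineMap x y t ∈ Ω}

/-- Hilbert's metric on a convex set `Ω` that meets every line through two of its points in an
open bounded segment: the logarithm of the cross-ratio `[x', x, y, y']`, where `x'` and `y'` are
the end-points of the segment cut out by `Ω` on the line through `x ≠ y`, the point `x` lying
between `x'` and `y`, and `y` lying between `x` and `y'`. -/
def hilbertDist {E : Type*} [NormedAddCommGroup E] [NormedSpace ℝ E] (Ω : Set E) (x y : E) : ℝ :=
  open Classical in
  if x = y then 0
  else
    Real.log (crossRatio
      (AffineMap.lineMap x y (sInf (lineParams Ω x y))) x y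
      (AffineMap.lineMap x y (sSup (lineParams Ω x y))))

/-- A map between two Hilbert geometries that preserves Hilbert's metric. -/
def IsHilbertIsometry {E F : Type*} [NormedAddCommGroup E] [NormedSpace ℝ E]
    [NormedAddCommGroup F] [NormedSpace ℝ F] {Ω₁ : Set E} {Ω₂ : Set F} (h : Ω₁ → Ω₂) : Prop :=
  ∀ x y : Ω₁, hilbertDist Ω₂ (h x : F) (h y : F) = hilbertDist Ω₁ (x : E) (y : E)

/-- The isometry group of a Hilbert geometry: the bijections of `Ω` onto itself that preserve
Hilbert's metric, under composition. -/
def isometryGroup {E : Type*} [NormedAddCommGroup E] [NormedSpace ℝ E] (Ω : Set E) :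
    Subgroup (Equiv.Perm Ω) where
  carrier := {e | IsHilbertIsometry (e : Ω → Ω)}
  one_mem' := fun _ _ => rfl
  mul_mem' := fun {a b} ha hb x y => (ha (b x) (b y)).trans (hb x y)
  inv_mem' := fun {a} ha x y => by
    have h := ha (a⁻¹ x) (a⁻¹ y)
    simpa using h.symm

variable {K : Type*} [TopologicalSpace K]

/-- A measure is strictly positive if every nonzero nonnegative continuous function has strictly
positive integral. -/
def IsStrictlyPositive [MeasurableSpace K] (μ : Measure K) : Prop :=
  ∀ f : C(K, ℝ), f ≠ 0 → (∀ x, 0 ≤ f x) → 0 < ∫ x, f x ∂μ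

/-- The (possibly infinite dimensional) open simplex `Δ(K, μ)°` of strictly positive continuous
functions of integral one. -/
def openSimplex [MeasurableSpace K] (μ : Measure K) : Set C(K, ℝ) :=
  {f | (∀ x, 0 < f x) ∧ ∫ x, f x ∂μ = 1}

variable (K) in
/-- The quotient of `C(K)` by the line of constant functions. -/
abbrev QuotConst : Type _ := C(K, ℝ) ⧸ Submodule.span ℝ {(1 : C(K, ℝ))}

/-- The linear map `f ↦ ε • (f ∘ θ⁻¹)` of `C(K)`. -/
def signCompLin (p : ℤˣ × (K ≃ₜ K)) : C(K, ℝ) →ₗ[ℝ] C(K, ℝ) where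
  toFun f := ((p.1 : ℤ) : ℝ) • f.comp (p.2.symm : C(K, K))
  map_add' f g := by ext x; simp
  map_smul' c f := by ext x; simp [mul_left_comm]

theorem signCompLin_le (p : ℤˣ × (K ≃ₜ K)) :
    Submodule.span ℝ {(1 : C(K, ℝ))} ≤
      (Submodule.span ℝ {(1 : C(K, ℝ))}).comap (signCompLin p) := by
  rw [Submodule.span_singleton_le_iff_mem, Submodule.mem_comap, Submodule.mem_span_singleton]
  exact ⟨((p.1 : ℤ) : ℝ), rfl⟩

/-- The map of `C(K)` modulo constants that sends the class of `f` to that of `ε • (f ∘ θ⁻¹)`. -/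
def signCompQuot (p : ℤˣ × (K ≃ₜ K)) : QuotConst K →ₗ[ℝ] QuotConst K :=
  Submodule.mapQ _ _ (signCompLin p) (signCompLin_le p)

theorem signCompQuot_one (a : QuotConst K) : signCompQuot 1 a = a := by
  obtain ⟨f, rfl⟩ := Submodule.Quotient.mk_surjective _ a
  refine congrArg Submodule.Quotient.mk (?_ : signCompLin 1 f = f)
  ext x
  simp [signCompLin]
  rfl

theorem signCompQuot_mul (p q : ℤˣ × (K ≃ₜ K)) (a : QuotConst K) :
    signCompQuot (p * q) a = signCompQuot p (signCompQuot q a) := by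
  obtain ⟨f, rfl⟩ := Submodule.Quotient.mk_surjective _ a
  refine congrArg Submodule.Quotient.mk
    (?_ : signCompLin (p * q) f = signCompLin p (signCompLin q f))
  ext x
  simp only [signCompLin, LinearMap.coe_mk, AddHom.coe_mk, ContinuousMap.smul_apply,
    ContinuousMap.comp_apply, Prod.fst_mul, Prod.snd_mul, Units.val_mul, Int.cast_mul, smul_eq_mul,
    mul_assoc]
  rfl

variable (K) in
/-- The action of `C₂ × Homeo(K)` by automorphisms on the additive group of `C(K)` modulo
constants: `(ε, θ)` sends the class of `f` to the class of `ε • (f ∘ θ⁻¹)`. The group `ℤˣ = {1, -1}`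
is the cyclic group of order two. -/
def signHomeoAction : ℤˣ × (K ≃ₜ K) →* MulAut (Multiplicative (QuotConst K)) where
  toFun p :=
    { toFun := fun a => Multiplicative.ofAdd (signCompQuot p a.toAdd)
      invFun := fun a => Multiplicative.ofAdd (signCompQuot p⁻¹ a.toAdd)
      left_inv := fun a => by
        simp [← signCompQuot_mul, signCompQuot_one]
      right_inv := fun a => by
        simp [← signCompQuot_mul, signCompQuot_one]
      map_mul' := fun a b => by simp }
  map_one' := by
    ext a
    exact signCompQuot_one a.toAdd
  map_mul' p q := by
    ext a
    exact signCompQuot_mul p q a.toAdd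

end

end HilbertGeometry

/-! Every ray of positive functions contains exactly one function of integral one, and the logarithm
turns scaling into adding a constant. So `logQuot` identifies the open simplex with all of
`QuotConst K`. If `M` and `m` are the maximum and minimum of `y / x`, the cross-ratio is `M / m`.
Hilbert's metric is therefore the oscillation of `log y - log x`, which is twice the quotient norm
(`hilbertDist_eq_norm_logQuot_sub`).

By Mazur–Ulam a surjective isometry then becomes a linear isometry `T` followed by a translation.
The translation gives the weight `g`. For `T` one uses that the functionals `evalDiff u v`, `u ≠ v`,
are determined by the faces of the unit ball on which they are maximal. Hence `T` pulls each of them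
back to another `evalDiff x y` (`exists_evalDiff_comp_eq`). The additivity `evalDiff u v + evalDiff
v w = evalDiff u w` forces these pairs to come from one point map `θ` with one global sign `ε`
(`pairMap_const_or_const`), and `θ` is a homeomorphism.

For the group, the maps `b ↦ a + ε (b ∘ θ⁻¹)` form a semidirect product that acts faithfully once
`K` has three points. -/

open MeasureTheory

namespace HilbertGeometry

/-! ### Oscillation norm on `C(K)` modulo constants, and its exposed faces. -/

section Quotient

variable {K : Type*} [TopologicalSpace K]

/-- The functional `f ↦ f x - f y` on `C(K)` modulo constants. -/
noncomputable def evalDiff (x y : K) : QuotConst K →ₗ[ℝ] ℝ :=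
  Submodule.liftQ _
    { toFun := fun f : C(K, ℝ) => f x - f y
      map_add' := fun f g => by simp; ring
      map_smul' := fun c f => by simp; ring }
    (by
      rw [Submodule.span_singleton_le_iff_mem]
      simp)

/-- The class of a continuous function modulo constants. -/
noncomputable def toQuot : C(K, ℝ) →ₗ[ℝ] QuotConst K := Submodule.mkQ _

theorem toQuot_surjective : Function.Surjective (toQuot (K := K)) :=
  Submodule.mkQ_surjective _

@[simp]
theorem evalDiff_toQuot (x y : K) (f : C(K, ℝ)) : evalDiff x y (toQuot f) = f x - f y := rfl

theorem toQuot_eq_iff {f g : C(K, ℝ)} : toQuot f = toQuot g ↔ ∃ c : ℝ, ∀ x, f x = g x + c := by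
  rw [toQuot, Submodule.mkQ_apply, Submodule.mkQ_apply, Submodule.Quotient.eq,
    Submodule.mem_span_singleton]
  refine exists_congr fun c => ⟨fun h x => ?_, fun h => ?_⟩
  · have := congrArg (fun k : C(K, ℝ) => k x) h
    simp at this
    linarith
  · ext x
    have := h x
    simp
    linarith

@[simp]
theorem toQuot_const (c : ℝ) : toQuot (ContinuousMap.const K c) = 0 := by
  rw [← map_zero toQuot, toQuot_eq_iff]
  exact ⟨c, fun x => by simp⟩

theorem evalDiff_swap (x y : K) (a : QuotConst K) : evalDiff x y a = -evalDiff y x a := by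
  obtain ⟨f, rfl⟩ := toQuot_surjective a
  simp

theorem evalDiff_add (x y z : K) (a : QuotConst K) :
    evalDiff x y a + evalDiff y z a = evalDiff x z a := by
  obtain ⟨f, rfl⟩ := toQuot_surjective a
  simp

theorem evalDiff_self (x : K) (a : QuotConst K) : evalDiff x x a = 0 := by
  obtain ⟨f, rfl⟩ := toQuot_surjective a
  simp

theorem continuous_evalDiff (a : QuotConst K) :
    Continuous fun p : K × K => evalDiff p.1 p.2 a := by
  obtain ⟨f, rfl⟩ := toQuot_surjective a
  simp only [evalDiff_toQuot]
  fun_prop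

variable [CompactSpace K]

instance isClosed_span_one :
    IsClosed ((Submodule.span ℝ {(1 : C(K, ℝ))} : Submodule ℝ C(K, ℝ)) : Set C(K, ℝ)) :=
  Submodule.closed_of_finiteDimensional _

theorem norm_toQuot_le (f : C(K, ℝ)) : ‖toQuot f‖ ≤ ‖f‖ :=
  Submodule.Quotient.norm_mk_le _ f

theorem evalDiff_le (x y : K) (a : QuotConst K) : evalDiff x y a ≤ 2 * ‖a‖ := by
  refine le_of_forall_pos_le_add fun ε hε => ?_
  obtain ⟨f, rfl, hf⟩ := Submodule.Quotient.norm_mk_lt a (half_pos hε)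
  change evalDiff x y (toQuot f) ≤ _
  rw [evalDiff_toQuot]
  have h1 := abs_le.1 (f.norm_coe_le_norm x)
  have h2 := abs_le.1 (f.norm_coe_le_norm y)
  linarith [h1.2, h2.1]

/-- The quotient norm is half of the oscillation, and the oscillation is attained. -/
theorem exists_evalDiff_eq [Nonempty K] (a : QuotConst K) :
    ∃ x y : K, evalDiff x y a = 2 * ‖a‖ := by
  obtain ⟨f, rfl⟩ := toQuot_surjective a
  obtain ⟨x, -, hx⟩ := isCompact_univ.exists_isMaxOn Set.univ_nonempty f.continuous.continuousOn
  obtain ⟨y, -, hy⟩ := isCompact_univ.exists_isMinOn Set.univ_nonempty f.continuous.continuousOn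
  refine ⟨x, y, (evalDiff_le x y _).antisymm ?_⟩
  have hc : toQuot f = toQuot (f - ContinuousMap.const K ((f x + f y) / 2)) := by
    rw [map_sub, toQuot_const, sub_zero]
  have hle : ‖f - ContinuousMap.const K ((f x + f y) / 2)‖ ≤ (f x - f y) / 2 := by
    have hxy : f y ≤ f x := hx (Set.mem_univ y)
    rw [ContinuousMap.norm_le _ (by linarith)]
    intro z
    have h1 : f z ≤ f x := hx (Set.mem_univ z)
    have h2 : f y ≤ f z := hy (Set.mem_univ z)
    simp only [ContinuousMap.sub_apply, ContinuousMap.const_apply, Real.norm_eq_abs, abs_le]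
    constructor <;> linarith
  have := (norm_toQuot_le _).trans hle
  rw [← hc] at this
  rw [evalDiff_toQuot]
  linarith

/-- If a functional is dominated by the oscillation, then the face of the unit ball on which it is
maximal lies in a face that is exposed by an evaluation difference. -/
theorem exists_evalDiff_eq_of_face [Nonempty K] (φ : QuotConst K →ₗ[ℝ] ℝ)
    (hφ : ∀ a, φ a ≤ 2 * ‖a‖) :
    ∃ x y : K, ∀ a, ‖a‖ ≤ 1 → φ a = 2 → evalDiff x y a = 2 := by
  let C := {a : QuotConst K // ‖a‖ ≤ 1 ∧ φ a = 2}
  -- Compactness of `K × K` reduces this to finitely many points of the face. A pair attaining the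
  -- oscillation of their sum works: each term is at most 2, while the bound on `φ` makes the total
  -- at least the sum of the 2's.
  have key := (isCompact_univ (X := K × K)).inter_iInter_nonempty
    (fun a : C => {p : K × K | evalDiff p.1 p.2 a.1 = 2})
    (fun a => isClosed_eq (continuous_evalDiff a.1) continuous_const) (by
      intro u
      obtain ⟨x, y, hxy⟩ := exists_evalDiff_eq (∑ a ∈ u, a.1)
      refine ⟨(x, y), Set.mem_univ _, ?_⟩
      have hle : ∀ a ∈ u, evalDiff x y a.1 ≤ 2 := fun a _ =>
        (evalDiff_le x y a.1).trans (by linarith [a.2.1])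
      have hge : ∑ a ∈ u, (2 : ℝ) ≤ ∑ a ∈ u, evalDiff x y a.1 := by
        calc ∑ a ∈ u, (2 : ℝ) = ∑ a ∈ u, φ a.1 := Finset.sum_congr rfl fun a _ => a.2.2.symm
          _ = φ (∑ a ∈ u, a.1) := (map_sum φ _ _).symm
          _ ≤ 2 * ‖∑ a ∈ u, a.1‖ := hφ _
          _ = evalDiff x y (∑ a ∈ u, a.1) := hxy.symm
          _ = _ := map_sum _ _ _
      have heq := (Finset.sum_eq_sum_iff_of_le hle).1 ((Finset.sum_le_sum hle).antisymm hge)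
      simpa using fun a ha => heq a ha)
  obtain ⟨⟨x, y⟩, -, h⟩ := key
  rw [Set.mem_iInter] at h
  exact ⟨x, y, fun a h1 h2 => h ⟨a, h1, h2⟩⟩

variable [T2Space K]

theorem exists_continuousMap_one_neg_one {u v : K} (huv : u ≠ v) :
    ∃ f : C(K, ℝ), f u = 1 ∧ f v = -1 ∧ ‖f‖ ≤ 1 := by
  obtain ⟨f, h0, h1, h⟩ := exists_continuous_zero_one_of_isClosed
    (isClosed_singleton (x := v)) (isClosed_singleton (x := u)) (by simpa using huv.symm)
  have h0 : f v = 0 := h0 rfl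
  have h1 : f u = 1 := h1 rfl
  refine ⟨(2 : ℝ) • f - ContinuousMap.const K 1, by simp [h1]; norm_num, by simp [h0], ?_⟩
  rw [ContinuousMap.norm_le _ zero_le_one]
  intro x
  simp only [ContinuousMap.sub_apply, ContinuousMap.smul_apply, ContinuousMap.const_apply,
    Real.norm_eq_abs, abs_le, smul_eq_mul]
  constructor <;> linarith [(h x).1, (h x).2]

theorem exists_norm_le_one_evalDiff {u v : K} (huv : u ≠ v) :
    ∃ a : QuotConst K, ‖a‖ ≤ 1 ∧ evalDiff u v a = 2 := by
  obtain ⟨f, hu, hv, hf⟩ := exists_continuousMap_one_neg_one huv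
  exact ⟨toQuot f, (norm_toQuot_le f).trans hf, by simp [hu, hv]; norm_num⟩

/-- A functional that equals `2` on the face exposed by `evalDiff u v` is `evalDiff u v`. -/
theorem eq_evalDiff_of_face {u v : K} (huv : u ≠ v) (ψ : QuotConst K →ₗ[ℝ] ℝ)
    (hψ : ∀ a, ‖a‖ ≤ 1 → evalDiff u v a = 2 → ψ a = 2) : ψ = evalDiff u v := by
  obtain ⟨a, hau, hav, ha⟩ := exists_continuousMap_one_neg_one huv
  have hψ' : ∀ f : C(K, ℝ), f u = 1 → f v = -1 → (∀ x, |f x| ≤ 1) → ψ (toQuot f) = 2 := by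
    intro f hu hv hf
    refine hψ _ ((norm_toQuot_le f).trans ((ContinuousMap.norm_le _ zero_le_one).2 hf)) ?_
    simp [hu, hv]
    norm_num
  -- Such an `f` is a difference of two elements of the face: `a` is clamped to a `g` for which both
  -- `g` and `g + f` take values in `[-1, 1]`. The bound `‖f‖ ≤ 2` is what makes the clamping
  -- interval nonempty.
  have small : ∀ f : C(K, ℝ), f u = 0 → f v = 0 → ‖f‖ ≤ 2 → ψ (toQuot f) = 0 := by
    intro f hu hv hf
    let g : C(K, ℝ) := ⟨fun x => max (max (-1) (-1 - f x)) (min (a x) (min 1 (1 - f x))),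
      by fun_prop⟩
    have hg : ∀ x, g x = max (max (-1) (-1 - f x)) (min (a x) (min 1 (1 - f x))) := fun _ => rfl
    have hb : ∀ x, max (-1) (-1 - f x) ≤ g x ∧ g x ≤ min 1 (1 - f x) := by
      intro x
      have := abs_le.1 ((f.norm_coe_le_norm x).trans hf)
      refine ⟨le_max_left _ _, max_le ?_ (min_le_right _ _)⟩
      refine max_le (le_min ?_ ?_) (le_min ?_ ?_) <;> linarith [this.1, this.2]
    have hgu : g u = 1 := by simp [hg, hu, hau]
    have hgv : g v = -1 := by simp [hg, hv, hav]
    have h1 := hψ' g hgu hgv fun x => by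
      have h := hb x
      simp only [max_le_iff, le_min_iff] at h
      exact abs_le.2 ⟨h.1.1, h.2.1⟩
    have h2 := hψ' (g + f) (by simp [hgu, hu]) (by simp [hgv, hv]) fun x => by
      have h := hb x
      simp only [max_le_iff, le_min_iff] at h
      rw [ContinuousMap.add_apply]
      exact abs_le.2 ⟨by linarith [h.1.2], by linarith [h.2.2]⟩
    rw [map_add, map_add, h1] at h2
    linarith
  have ker : ∀ f : C(K, ℝ), f u = 0 → f v = 0 → ψ (toQuot f) = 0 := by
    intro f hu hv
    have hn : 0 < ‖f‖ + 1 := by positivity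
    have h := small ((‖f‖ + 1)⁻¹ • f) (by simp [hu]) (by simp [hv]) (by
      rw [norm_smul, norm_inv, Real.norm_of_nonneg hn.le, inv_mul_le_iff₀ hn]
      linarith [norm_nonneg f])
    rw [map_smul, map_smul, smul_eq_mul] at h
    exact (mul_eq_zero.1 h).resolve_left (inv_ne_zero hn.ne')
  refine LinearMap.ext fun b => ?_
  obtain ⟨f, rfl⟩ := toQuot_surjective b
  -- Since `a` is `1` at `u` and `-1` at `v`, a multiple of `a` plus a constant interpolates `f` at
  -- both points.
  have h := ker (f - ((f u - f v) / 2) • a - ContinuousMap.const K ((f u + f v) / 2))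
    (by simp [hau]; ring) (by simp [hav]; ring)
  have haψ := hψ' a hau hav fun x => (a.norm_coe_le_norm x).trans ha
  simp only [map_sub, map_smul, toQuot_const, haψ, smul_eq_mul, map_zero] at h
  rw [evalDiff_toQuot]
  linarith

open Classical in
theorem exists_continuousMap_eq_ite (s : Finset K) (z : K) :
    ∃ f : C(K, ℝ), ∀ w ∈ s, f w = if w = z then 1 else 0 := by
  obtain ⟨f, h0, h1, -⟩ := exists_continuous_zero_one_of_isClosed
    (s.erase z).finite_toSet.isClosed (isClosed_singleton (x := z)) (by simp)
  refine ⟨f, fun w hw => ?_⟩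
  split_ifs with hwz
  · exact h1 hwz
  · exact h0 (by simp [hw, hwz])

/-- Evaluations at distinct points are linearly independent, so the coefficients of the point masses
agree; one endpoint of each difference on the left must cancel. -/
theorem evalDiff_add_eq_cases {a b c d e f : K} (hab : a ≠ b) (hcd : c ≠ d) (hef : e ≠ f)
    (h : ∀ q, evalDiff a b q + evalDiff c d q = evalDiff e f q) :
    (b = c ∧ a = e ∧ d = f) ∨ (a = d ∧ c = e ∧ b = f) := by
  classical
  have key : ∀ z : K, ((if a = z then 1 else 0) - (if b = z then 1 else 0) +
      ((if c = z then 1 else 0) - (if d = z then 1 else 0)) : ℝ) =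
      (if e = z then 1 else 0) - (if f = z then 1 else 0) := by
    intro z
    obtain ⟨g, hg⟩ := exists_continuousMap_eq_ite {a, b, c, d, e, f} z
    have := h (toQuot g)
    simpa only [evalDiff_toQuot, hg, Finset.mem_insert, Finset.mem_singleton, true_or, or_true]
      using this
  have ha := key a
  have hb := key b
  have hc := key c
  have hd := key d
  have he := key e
  have hf := key f
  grind

end Quotient

/-! ### Combinatorics of maps on ordered pairs. -/

/-- Think of the pair `(u, v)` as sent to `(P u v, P v u)`. The triangle condition makes one slot
constant at each point; two points of opposite type, together with a third point, would violate it.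
The two outcomes become the signs `1` and `-1`. -/
theorem pairMap_const_or_const {X Y : Type*} {P : X → X → Y}
    (hne : ∀ u v, u ≠ v → P u v ≠ P v u)
    (h : ∀ u v w, u ≠ v → v ≠ w → u ≠ w →
      (P v u = P v w ∧ P u v = P u w ∧ P w v = P w u) ∨
        (P u v = P w v ∧ P v w = P u w ∧ P v u = P w u)) :
    (∀ u v w, v ≠ u → w ≠ u → P u v = P u w) ∨ (∀ u v w, v ≠ u → w ≠ u → P v u = P w u) := by
  have local_or : ∀ u, (∀ v w, v ≠ u → w ≠ u → P u v = P u w) ∨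
      (∀ v w, v ≠ u → w ≠ u → P v u = P w u) := by
    intro u
    have share : ∀ v w, v ≠ u → w ≠ u → P u v = P u w ∨ P v u = P w u := by
      intro v w hv hw
      by_cases hvw : v = w
      · exact Or.inl (by rw [hvw])
      · rcases h u v w hv.symm hvw hw.symm with h' | h'
        · exact Or.inl h'.2.1
        · exact Or.inr h'.2.2
    by_contra! hcon
    obtain ⟨⟨v, w, hv, hw, hvw⟩, v', w', hv', hw', hvw'⟩ := hcon
    grind
  by_contra! hcon
  obtain ⟨⟨u, v, w, hv, hw, huvw⟩, u', v', w', hv', hw', huvw'⟩ := hcon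
  have hu := (local_or u).resolve_left fun h' => huvw (h' v w hv hw)
  have hu' := (local_or u').resolve_right fun h' => huvw' (h' v' w' hv' hw')
  have huu' : u ≠ u' := by
    rintro rfl
    exact huvw (hu' v w hv hw)
  -- A third point exists because `P u` takes different values at `v` and `w`, so these cannot both
  -- be `u'`.
  obtain ⟨z, hzu, hzu'⟩ : ∃ z, z ≠ u ∧ z ≠ u' := by
    by_cases hvu' : v = u'
    · refine ⟨w, hw, fun hwu' => huvw (by rw [hvu', hwu'])⟩
    · exact ⟨v, hv, hvu'⟩
  have h1 := hu u' z huu'.symm hzu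
  have h2 := hu' u z huu' hzu'
  have h3 := hne u u' huu'
  have h4 := hne u z hzu.symm
  have h5 := hne u' z hzu'.symm
  have h6 := h u u' z huu' hzu'.symm hzu.symm
  grind

/-! ### Linear isometries as signed composition operators. -/

section LinearIsometry

variable {K₁ K₂ : Type*} [TopologicalSpace K₁] [CompactSpace K₁]
  [TopologicalSpace K₂] [CompactSpace K₂] [T2Space K₂]

/-- The face where `evalDiff u v ∘ T` is maximal lies in the face of some `evalDiff x y`. Carried
back by `T.symm`, this `evalDiff x y` equals 2 on the face of `evalDiff u v`, hence coincides with
it. -/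
theorem exists_evalDiff_comp_eq [Nonempty K₁] (T : QuotConst K₁ ≃ₗᵢ[ℝ] QuotConst K₂) {u v : K₂}
    (huv : u ≠ v) :
    ∃ p : K₁ × K₁, p.1 ≠ p.2 ∧ ∀ a, evalDiff u v (T a) = evalDiff p.1 p.2 a := by
  obtain ⟨x, y, hxy⟩ := exists_evalDiff_eq_of_face
    (evalDiff u v ∘ₗ (T.toLinearEquiv : QuotConst K₁ →ₗ[ℝ] QuotConst K₂))
    (fun a => (evalDiff_le u v (T a)).trans_eq (by rw [T.norm_map]))
  have heq := eq_evalDiff_of_face huv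
    (evalDiff x y ∘ₗ (T.symm.toLinearEquiv : QuotConst K₂ →ₗ[ℝ] QuotConst K₁))
    (fun b hb h => hxy (T.symm b) (by rwa [T.symm.norm_map]) (by simpa using h))
  have heq' : ∀ a, evalDiff u v (T a) = evalDiff x y a := fun a =>
    (LinearMap.congr_fun heq (T a)).symm.trans
      (congrArg (evalDiff x y) (T.symm_apply_apply a))
  refine ⟨(x, y), ?_, heq'⟩
  rintro (rfl : x = y)
  obtain ⟨b, -, hb⟩ := exists_norm_le_one_evalDiff huv
  have := heq' (T.symm b)
  rw [T.apply_symm_apply, hb, evalDiff_self] at this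
  norm_num at this

variable [T2Space K₁]

theorem exists_sign_map [Nonempty K₁] (T : QuotConst K₁ ≃ₗᵢ[ℝ] QuotConst K₂) :
    ∃ (ε : ℤˣ) (θ : K₂ → K₁), ∀ u v a,
      evalDiff u v (T a) = ((ε : ℤ) : ℝ) * evalDiff (θ u) (θ v) a := by
  classical
  rcases subsingleton_or_nontrivial K₂ with hs | hn
  · refine ⟨1, fun _ => Classical.arbitrary K₁, fun u v a => ?_⟩
    rw [Subsingleton.elim u v, evalDiff_self, evalDiff_self, mul_zero]
  have hex : ∀ u v : K₂, ∃ p : K₁ × K₁, u ≠ v →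
      p.1 ≠ p.2 ∧ ∀ a, evalDiff u v (T a) = evalDiff p.1 p.2 a := by
    intro u v
    by_cases huv : u = v
    · exact ⟨Classical.arbitrary _, fun h => absurd huv h⟩
    · obtain ⟨p, hp⟩ := exists_evalDiff_comp_eq T huv
      exact ⟨p, fun _ => hp⟩
  choose Φ hΦ using hex
  -- Antisymmetry of `evalDiff`, tested on a function that isolates the point `(Φ u v).2`.
  have hswap : ∀ u v, u ≠ v → (Φ u v).2 = (Φ v u).1 := by
    intro u v huv
    by_contra hne
    obtain ⟨h1, h2⟩ := hΦ u v huv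
    obtain ⟨h3, h4⟩ := hΦ v u huv.symm
    obtain ⟨f, hf⟩ := exists_continuousMap_eq_ite
      {(Φ u v).1, (Φ u v).2, (Φ v u).1, (Φ v u).2} (Φ u v).2
    have := evalDiff_swap u v (T (toQuot f))
    rw [h2, h4, evalDiff_toQuot, evalDiff_toQuot, hf _ (by simp), hf _ (by simp),
      hf _ (by simp), hf _ (by simp), if_neg h1, if_pos rfl, if_neg (Ne.symm hne)] at this
    split_ifs at this <;> norm_num at this
  let P : K₂ → K₂ → K₁ := fun u v => (Φ u v).1
  have hP : ∀ u v, u ≠ v → ∀ a, evalDiff u v (T a) = evalDiff (P u v) (P v u) a := by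
    intro u v huv a
    rw [(hΦ u v huv).2 a, hswap u v huv]
  have hne : ∀ u v, u ≠ v → P u v ≠ P v u := fun u v huv => by
    have := (hΦ u v huv).1
    rwa [hswap u v huv] at this
  have htri : ∀ u v w, u ≠ v → v ≠ w → u ≠ w →
      (P v u = P v w ∧ P u v = P u w ∧ P w v = P w u) ∨
        (P u v = P w v ∧ P v w = P u w ∧ P v u = P w u) := by
    intro u v w huv hvw huw
    refine evalDiff_add_eq_cases (hne u v huv) (hne v w hvw) (hne u w huw) fun q => ?_
    rw [← hP u v huv, ← hP v w hvw, ← hP u w huw, evalDiff_add]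
  choose o ho using fun u : K₂ => exists_ne u
  rcases pairMap_const_or_const hne htri with h | h
  · refine ⟨1, fun u => P u (o u), fun u v a => ?_⟩
    by_cases huv : u = v
    · rw [huv, evalDiff_self, evalDiff_self, mul_zero]
    · beta_reduce
      rw [hP u v huv, h u (o u) v (ho u) (Ne.symm huv), h v (o v) u (ho v) huv]
      simp
  · refine ⟨-1, fun u => P (o u) u, fun u v a => ?_⟩
    by_cases huv : u = v
    · rw [huv, evalDiff_self, evalDiff_self, mul_zero]
    · beta_reduce
      rw [hP u v huv, h u (o u) v (ho u) (Ne.symm huv), h v (o v) u (ho v) huv, evalDiff_swap]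
      simp

theorem exists_one_zero_of_notMem {K : Type*} [TopologicalSpace K] [CompactSpace K] [T2Space K]
    {s : Set K} (hs : IsClosed s) {x : K} (hx : x ∉ s) :
    ∃ f : C(K, ℝ), f x = 1 ∧ ∀ y ∈ s, f y = 0 := by
  obtain ⟨f, h0, h1, -⟩ := exists_continuous_zero_one_of_isClosed hs
    (isClosed_singleton (x := x)) (by simpa using hx)
  exact ⟨f, h1 rfl, fun y hy => h0 hy⟩

/-- Linear isometries between the spaces of continuous functions modulo constants are signed
composition operators. -/
theorem exists_sign_homeomorph [Nonempty K₁] [Nonempty K₂]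
    (T : QuotConst K₁ ≃ₗᵢ[ℝ] QuotConst K₂) :
    ∃ (ε : ℤˣ) (θ : K₂ ≃ₜ K₁), ∀ f : C(K₁, ℝ),
      T (toQuot f) = toQuot (((ε : ℤ) : ℝ) • f.comp (θ : C(K₂, K₁))) := by
  obtain ⟨ε, θ, h⟩ := exists_sign_map T
  have hε : ((ε : ℤ) : ℝ) * ((ε : ℤ) : ℝ) = 1 := by
    rcases Int.units_eq_one_or ε with rfl | rfl <;> simp
  -- With `v` fixed and `ε² = 1`, the identity `h` expresses `f ∘ θ` through a continuous
  -- representative of `T (toQuot f)`.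
  have hcomp : ∀ f : C(K₁, ℝ), Continuous (f ∘ θ) := by
    intro f
    obtain ⟨k, hk⟩ := toQuot_surjective (T (toQuot f))
    let v := Classical.arbitrary K₂
    have : f ∘ θ = fun u => ((ε : ℤ) : ℝ) * (k u - k v) + f (θ v) := by
      ext u
      have h' := h u v (toQuot f)
      rw [← hk, evalDiff_toQuot, evalDiff_toQuot] at h'
      rw [h', ← mul_assoc, hε, Function.comp_apply]
      ring
    rw [this]
    fun_prop
  have hcont : Continuous θ := by
    refine continuous_iff_continuousAt.2 fun u => ?_
    rw [ContinuousAt, tendsto_nhds]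
    intro V hV hu
    obtain ⟨f, hf, hf0⟩ := exists_one_zero_of_notMem hV.isClosed_compl (x := θ u) (by simpa using hu)
    have hopen : IsOpen ((f ∘ θ) ⁻¹' Set.Ioi 0) := isOpen_Ioi.preimage (hcomp f)
    refine Filter.mem_of_superset (hopen.mem_nhds (by simp [hf])) fun w hw => ?_
    by_contra hwV
    have : f (θ w) = 0 := hf0 _ hwV
    simp [this] at hw
  have hinj : Function.Injective θ := by
    intro u v huv
    by_contra hne
    obtain ⟨b, -, hb⟩ := exists_norm_le_one_evalDiff hne
    have := h u v (T.symm b)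
    rw [T.apply_symm_apply, hb, huv, evalDiff_self] at this
    norm_num at this
  -- A function that is 1 at a missed point and 0 on the range of `θ` would have an image of norm
  -- zero despite its positive oscillation.
  have hsurj : Function.Surjective θ := by
    intro x
    by_contra hx
    obtain ⟨f, hf, hf0⟩ := exists_one_zero_of_notMem (isCompact_range hcont).isClosed
      (x := x) (by simpa using hx)
    have hf0' : ∀ u, f (θ u) = 0 := fun u => hf0 _ ⟨u, rfl⟩
    obtain ⟨u, v, huv⟩ := exists_evalDiff_eq (T (toQuot f))
    rw [h, evalDiff_toQuot, hf0', hf0', T.norm_map] at huv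
    have := evalDiff_le x (θ u) (toQuot f)
    rw [evalDiff_toQuot, hf, hf0'] at this
    linarith
  let e : K₂ ≃ₜ K₁ := Continuous.homeoOfEquivCompactToT2 (f := Equiv.ofBijective θ ⟨hinj, hsurj⟩)
    hcont
  refine ⟨ε, e, fun f => ?_⟩
  obtain ⟨k, hk⟩ := toQuot_surjective (T (toQuot f))
  rw [← hk, toQuot_eq_iff]
  let v := Classical.arbitrary K₂
  refine ⟨k v - ((ε : ℤ) : ℝ) * f (θ v), fun u => ?_⟩
  have h' := h u v (toQuot f)
  rw [← hk, evalDiff_toQuot, evalDiff_toQuot] at h'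
  change k u = ((ε : ℤ) : ℝ) * f (θ u) + _
  linarith

end LinearIsometry

/-! ### Hilbert's metric in logarithmic coordinates. -/

theorem crossRatio_lineMap {E : Type*} [NormedAddCommGroup E] [NormedSpace ℝ E] {x y : E}
    (hxy : x ≠ y) (s t : ℝ) :
    crossRatio (AffineMap.lineMap x y s) x y (AffineMap.lineMap x y t) =
      |s - 1| / |s| * (|t| / |t - 1|) := by
  have hn : ‖y - x‖ ≠ 0 := norm_ne_zero_iff.2 (sub_ne_zero.2 hxy.symm)
  have h1 : ∀ r : ℝ, ‖AffineMap.lineMap x y r - y‖ = |r - 1| * ‖y - x‖ := fun r => by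
    rw [← Real.norm_eq_abs, ← norm_smul, AffineMap.lineMap_apply_module']
    congr 1
    module
  have h2 : ∀ r : ℝ, ‖AffineMap.lineMap x y r - x‖ = |r| * ‖y - x‖ := fun r => by
    rw [← Real.norm_eq_abs, ← norm_smul, AffineMap.lineMap_apply_module']
    congr 1
    module
  rw [crossRatio, h1, h1, h2, h2, mul_div_mul_right _ _ hn, mul_div_mul_right _ _ hn]

section Simplex

variable {K : Type*} [TopologicalSpace K]

/-- The logarithm of a positive continuous function. -/
noncomputable def logMap (f : C(K, ℝ)) (hf : ∀ x, 0 < f x) : C(K, ℝ) :=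
  ⟨fun x => Real.log (f x), f.continuous.log fun x => (hf x).ne'⟩

@[simp]
theorem logMap_apply (f : C(K, ℝ)) (hf : ∀ x, 0 < f x) (x : K) :
    logMap f hf x = Real.log (f x) := rfl

theorem exists_logMap_eq (k : C(K, ℝ)) : ∃ (g : C(K, ℝ)) (hg : ∀ x, 0 < g x), logMap g hg = k :=
  ⟨⟨fun x => Real.exp (k x), by fun_prop⟩, fun x => Real.exp_pos _, by ext x; simp⟩

variable [MeasurableSpace K] {μ : Measure K}

theorem IsStrictlyPositive.integral_pos [Nonempty K] (hμ : IsStrictlyPositive μ) (f : C(K, ℝ))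
    (hf : ∀ x, 0 < f x) : 0 < ∫ x, f x ∂μ := by
  refine hμ f (fun h => ?_) fun x => (hf x).le
  have := hf (Classical.arbitrary K)
  simp [h] at this

/-- The class of the logarithm of an element of the open simplex. -/
noncomputable def logQuot (f : openSimplex μ) : QuotConst K := toQuot (logMap f.1 f.2.1)

theorem logQuot_eq_iff [Nonempty K] (hμ : IsStrictlyPositive μ) (f : openSimplex μ) (g : C(K, ℝ))
    (hg : ∀ x, 0 < g x) :
    logQuot f = toQuot (logMap g hg) ↔ ∀ x, f.1 x = g x / ∫ y, g y ∂μ := by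
  have hpos := hμ.integral_pos g hg
  rw [logQuot, toQuot_eq_iff]
  constructor
  · rintro ⟨c, hc⟩
    have hfg : ∀ x, f.1 x = Real.exp c * g x := fun x => by
      have h := hc x
      rw [logMap_apply, logMap_apply] at h
      rw [← Real.exp_log (f.2.1 x), h, Real.exp_add, Real.exp_log (hg x), mul_comm]
    have hint := f.2.2
    simp only [hfg] at hint
    rw [integral_const_mul] at hint
    intro x
    rw [hfg, eq_div_iff hpos.ne', mul_right_comm, hint, one_mul]
  · intro h
    refine ⟨-Real.log (∫ y, g y ∂μ), fun x => ?_⟩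
    rw [logMap_apply, logMap_apply, h, Real.log_div (hg x).ne' hpos.ne', sub_eq_add_neg]

theorem logQuot_injective [Nonempty K] (hμ : IsStrictlyPositive μ) :
    Function.Injective (logQuot (μ := μ)) := by
  intro f g h
  have := (logQuot_eq_iff hμ f g.1 g.2.1).1 h
  ext x
  rw [this x, g.2.2, div_one]

theorem logQuot_surjective [Nonempty K] (hμ : IsStrictlyPositive μ) :
    Function.Surjective (logQuot (μ := μ)) := by
  intro a
  obtain ⟨k, rfl⟩ := toQuot_surjective a
  obtain ⟨g, hg, rfl⟩ := exists_logMap_eq k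
  have hpos := hμ.integral_pos g hg
  refine ⟨⟨(∫ x, g x ∂μ)⁻¹ • g, fun x => ?_, ?_⟩, ?_⟩
  · exact mul_pos (inv_pos.2 hpos) (hg x)
  · simp only [ContinuousMap.smul_apply, smul_eq_mul]
    rw [integral_const_mul, inv_mul_cancel₀ hpos.ne']
  · rw [logQuot_eq_iff hμ]
    intro x
    simp [div_eq_inv_mul]

theorem nonempty_openSimplex_iff (hμ : IsStrictlyPositive μ) :
    Nonempty (openSimplex μ) ↔ Nonempty K := by
  constructor
  · rintro ⟨f⟩
    by_contra hK
    rw [not_nonempty_iff] at hK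
    have := f.2.2
    rw [integral_of_isEmpty] at this
    exact zero_ne_one this
  · intro hK
    obtain ⟨f, -⟩ := logQuot_surjective hμ 0
    exact ⟨f⟩

variable [CompactSpace K] [BorelSpace K] [IsFiniteMeasure μ]

theorem integrable_continuousMap (f : C(K, ℝ)) : Integrable f μ := by
  refine Integrable.of_bound f.continuous.measurable.aestronglyMeasurable ‖f‖ ?_
  exact Filter.Eventually.of_forall f.norm_coe_le_norm

/-- Two continuous functions with the same integral that are ordered pointwise agree. -/
theorem IsStrictlyPositive.eq_of_le (hμ : IsStrictlyPositive μ) {f g : C(K, ℝ)}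
    (hle : ∀ x, f x ≤ g x) (hint : ∫ x, f x ∂μ = ∫ x, g x ∂μ) : f = g := by
  by_contra hne
  have := hμ (g - f) (sub_ne_zero.2 (Ne.symm hne)) fun x => sub_nonneg.2 (hle x)
  simp only [ContinuousMap.sub_apply] at this
  rw [integral_sub (integrable_continuousMap g) (integrable_continuousMap f), hint] at this
  simp at this

/-- The integral stays 1 along the line, so only positivity of `1 + t (y / x - 1)` matters. For `t ≥
0` it is tightest at the minimum `q` of `y / x`, for `t ≤ 0` at the maximum `p`. -/
theorem lineParams_openSimplex {x y : C(K, ℝ)} (hx : x ∈ openSimplex μ) (hy : y ∈ openSimplex μ)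
    {p q : K} (hp : ∀ z, y z / x z ≤ y p / x p) (hq : ∀ z, y q / x q ≤ y z / x z)
    (hp1 : 1 < y p / x p) (hq1 : y q / x q < 1) :
    lineParams (openSimplex μ) x y =
      Set.Ioo (-(y p / x p - 1)⁻¹) (1 - y q / x q)⁻¹ := by
  have hM := sub_pos.2 hp1
  have hm := sub_pos.2 hq1
  have happ : ∀ (t : ℝ) (z : K),
      (AffineMap.lineMap x y t : C(K, ℝ)) z = x z * (1 + t * (y z / x z - 1)) := by
    intro t z
    have := (hx.1 z).ne'
    rw [AffineMap.lineMap_apply_module']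
    simp only [ContinuousMap.add_apply, ContinuousMap.smul_apply, ContinuousMap.sub_apply,
      smul_eq_mul]
    field_simp
    ring
  have hint : ∀ t : ℝ, ∫ z, (AffineMap.lineMap x y t : C(K, ℝ)) z ∂μ = 1 := by
    intro t
    rw [AffineMap.lineMap_apply_module]
    simp only [ContinuousMap.add_apply, ContinuousMap.smul_apply, smul_eq_mul]
    rw [integral_add ((integrable_continuousMap x).const_mul _)
      ((integrable_continuousMap y).const_mul _), integral_const_mul, integral_const_mul,
      hx.2, hy.2]
    ring
  ext t
  have hleft : -(y p / x p - 1)⁻¹ < t ↔ 0 < 1 + t * (y p / x p - 1) := by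
    rw [neg_lt, inv_eq_one_div, lt_div_iff₀ hM]
    constructor <;> intro h <;> linarith
  have hright : t < (1 - y q / x q)⁻¹ ↔ 0 < 1 + t * (y q / x q - 1) := by
    rw [inv_eq_one_div, lt_div_iff₀ hm]
    constructor <;> intro h <;> linarith
  rw [Set.mem_Ioo, hleft, hright]
  constructor
  · intro h
    have h' : ∀ z, 0 < 1 + t * (y z / x z - 1) := fun z => by
      have := h.1 z
      rw [happ] at this
      exact pos_of_mul_pos_right this (hx.1 z).le
    exact ⟨h' p, h' q⟩
  · rintro ⟨h1, h2⟩
    refine ⟨fun z => ?_, hint t⟩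
    rw [happ]
    refine mul_pos (hx.1 z) ?_
    rcases le_total 0 t with ht | ht
    · nlinarith [mul_le_mul_of_nonneg_left (hq z) ht]
    · nlinarith [mul_le_mul_of_nonpos_left (hp z) ht]

/-- The logarithm turns Hilbert's metric into the oscillation norm. -/
theorem hilbertDist_eq_norm_logQuot_sub (hμ : IsStrictlyPositive μ) (f g : openSimplex μ) :
    hilbertDist (openSimplex μ) (f : C(K, ℝ)) (g : C(K, ℝ)) = 2 * ‖logQuot f - logQuot g‖ := by
  obtain ⟨x, hx⟩ := f
  obtain ⟨y, hy⟩ := g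
  by_cases hxy : x = y
  · subst hxy
    rw [hilbertDist, if_pos rfl, sub_self, norm_zero (E := QuotConst K), mul_zero]
  have hK : Nonempty K := by
    by_contra hK
    rw [not_nonempty_iff] at hK
    exact hxy (ContinuousMap.ext fun z => hK.elim z)
  have hne := fun z => (hx.1 z).ne'
  have hr : ∀ z, 0 < y z / x z := fun z => div_pos (hy.1 z) (hx.1 z)
  have hD : ∀ z w, evalDiff z w (logQuot ⟨y, hy⟩ - logQuot ⟨x, hx⟩) =
      Real.log (y z / x z) - Real.log (y w / x w) := by
    intro z w
    rw [logQuot, logQuot, ← map_sub, evalDiff_toQuot,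
      Real.log_div (hy.1 z).ne' (hne z), Real.log_div (hy.1 w).ne' (hne w)]
    rfl
  obtain ⟨p, q, hpq⟩ := exists_evalDiff_eq (logQuot ⟨y, hy⟩ - logQuot ⟨x, hx⟩)
  have hmax : ∀ z w, Real.log (y z / x z) - Real.log (y w / x w) ≤
      Real.log (y p / x p) - Real.log (y q / x q) := by
    intro z w
    rw [← hD, ← hD, hpq]
    exact evalDiff_le _ _ _
  have hp : ∀ z, y z / x z ≤ y p / x p := fun z =>
    (Real.log_le_log_iff (hr z) (hr p)).1 (by linarith [hmax z q])
  have hq : ∀ z, y q / x q ≤ y z / x z := fun z =>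
    (Real.log_le_log_iff (hr q) (hr z)).1 (by linarith [hmax p z])
  -- Otherwise `y ≤ x` with equal integrals, and strict positivity of `μ` gives `x = y`; likewise
  -- for `hq1`.
  have hp1 : 1 < y p / x p := by
    by_contra! h
    exact hxy (hμ.eq_of_le (fun z => (div_le_one (hx.1 z)).1 ((hp z).trans h))
      (hy.2.trans hx.2.symm)).symm
  have hq1 : y q / x q < 1 := by
    by_contra! h
    exact hxy (hμ.eq_of_le (fun z => (one_le_div (hx.1 z)).1 (h.trans (hq z)))
      (hx.2.trans hy.2.symm))
  rw [hilbertDist, if_neg hxy, lineParams_openSimplex hx hy hp hq hp1 hq1,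
    norm_sub_rev (logQuot ⟨x, hx⟩) (logQuot ⟨y, hy⟩), ← hpq, hD]
  have hM := sub_pos.2 hp1
  have hm := sub_pos.2 hq1
  have hlt : -(y p / x p - 1)⁻¹ < (1 - y q / x q)⁻¹ :=
    (neg_neg_of_pos (inv_pos.2 hM)).trans (inv_pos.2 hm)
  rw [csInf_Ioo hlt, csSup_Ioo hlt, crossRatio_lineMap hxy,
    ← Real.log_div (hr p).ne' (hr q).ne']
  congr 1
  have hrp := hr p
  have hrq := hr q
  generalize y p / x p = M at *
  generalize y q / x q = m at *
  have e1 : -(M - 1)⁻¹ - 1 = -(M * (M - 1)⁻¹) := by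
    field_simp
    ring
  have e2 : (1 - m)⁻¹ - 1 = m * (1 - m)⁻¹ := by
    field_simp
    ring
  have i1 := inv_pos.2 hM
  have i2 := inv_pos.2 hm
  rw [e1, e2, abs_neg, abs_neg, abs_mul, abs_mul, abs_of_pos i1, abs_of_pos i2, abs_of_pos hrp,
    abs_of_pos hrq, mul_div_cancel_right₀ _ i1.ne', div_mul_cancel_right₀ i2.ne', div_eq_mul_inv]

end Simplex

/-! ### Signed composition operators are isometries. -/

section SignPullback

variable {K₁ K₂ : Type*} [TopologicalSpace K₁] [TopologicalSpace K₂]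

/-- The map `f ↦ ε • (f ∘ θ)` between spaces of continuous functions modulo constants. -/
noncomputable def signPullback (ε : ℤˣ) (θ : K₂ ≃ₜ K₁) : QuotConst K₁ →ₗ[ℝ] QuotConst K₂ :=
  Submodule.liftQ _
    (toQuot ∘ₗ
      { toFun := fun f : C(K₁, ℝ) => ((ε : ℤ) : ℝ) • f.comp (θ : C(K₂, K₁))
        map_add' := fun f g => by ext x; simp
        map_smul' := fun c f => by ext x; simp [mul_left_comm] })
    (by
      rw [Submodule.span_singleton_le_iff_mem, LinearMap.mem_ker, ← toQuot_const ((ε : ℤ) : ℝ)]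
      refine congrArg toQuot ?_
      ext x
      simp)

@[simp]
theorem signPullback_toQuot (ε : ℤˣ) (θ : K₂ ≃ₜ K₁) (f : C(K₁, ℝ)) :
    signPullback ε θ (toQuot f) = toQuot (((ε : ℤ) : ℝ) • f.comp (θ : C(K₂, K₁))) := rfl

theorem signCompQuot_eq (p : ℤˣ × (K₁ ≃ₜ K₁)) (a : QuotConst K₁) :
    signCompQuot p a = signPullback p.1 p.2.symm a := by
  obtain ⟨f, rfl⟩ := toQuot_surjective a
  rfl

theorem evalDiff_signPullback (ε : ℤˣ) (θ : K₂ ≃ₜ K₁) (u v : K₂) (a : QuotConst K₁) :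
    evalDiff u v (signPullback ε θ a) = ((ε : ℤ) : ℝ) * evalDiff (θ u) (θ v) a := by
  obtain ⟨f, rfl⟩ := toQuot_surjective a
  simp [mul_sub]

theorem signPullback_signPullback_symm (ε : ℤˣ) (θ : K₂ ≃ₜ K₁) (b : QuotConst K₂) :
    signPullback ε θ (signPullback ε θ.symm b) = b := by
  obtain ⟨f, rfl⟩ := toQuot_surjective b
  rw [signPullback_toQuot, signPullback_toQuot]
  congr 1
  ext x
  rcases Int.units_eq_one_or ε with rfl | rfl <;> simp

variable [CompactSpace K₁] [CompactSpace K₂]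

theorem norm_signPullback_le [Nonempty K₂] (ε : ℤˣ) (θ : K₂ ≃ₜ K₁) (a : QuotConst K₁) :
    ‖signPullback ε θ a‖ ≤ ‖a‖ := by
  obtain ⟨u, v, huv⟩ := exists_evalDiff_eq (signPullback ε θ a)
  rw [evalDiff_signPullback] at huv
  have h1 := evalDiff_le (θ u) (θ v) a
  have h2 := evalDiff_le (θ v) (θ u) a
  rw [evalDiff_swap] at h2
  rcases Int.units_eq_one_or ε with rfl | rfl <;> simp at huv <;> linarith

theorem norm_signPullback [Nonempty K₁] [Nonempty K₂] (ε : ℤˣ) (θ : K₂ ≃ₜ K₁) (a : QuotConst K₁) :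
    ‖signPullback ε θ a‖ = ‖a‖ := by
  refine (norm_signPullback_le ε θ a).antisymm ?_
  have := norm_signPullback_le ε θ.symm (signPullback ε θ a)
  rwa [← θ.symm_symm, θ.symm.symm_symm, signPullback_signPullback_symm] at this

end SignPullback

/-! ### Surjective isometries of open simplices. -/

section Isometries

variable {K₁ K₂ : Type*} [TopologicalSpace K₁] [TopologicalSpace K₂]
  [MeasurableSpace K₁] [MeasurableSpace K₂] {μ₁ : Measure K₁} {μ₂ : Measure K₂}

/-- Under the logarithm the weight becomes a translation, the power a sign, and the normalising
integral a constant that vanishes in the quotient. -/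
theorem eq_weighted_comp_iff [Nonempty K₂] (hμ₂ : IsStrictlyPositive μ₂) (ε : ℤˣ) (θ : K₂ ≃ₜ K₁)
    (g : C(K₂, ℝ)) (hg : ∀ x, 0 < g x) (f : openSimplex μ₁) (k : openSimplex μ₂) :
    (∀ x, (k : C(K₂, ℝ)) x = g x * (f : C(K₁, ℝ)) (θ x) ^ (ε : ℤ) /
        ∫ y, g y * (f : C(K₁, ℝ)) (θ y) ^ (ε : ℤ) ∂μ₂) ↔
      logQuot k = toQuot (logMap g hg) + signPullback ε θ (logQuot f) := by
  have hpos := f.2.1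
  let G : C(K₂, ℝ) := ⟨fun y => g y * f.1 (θ y) ^ (ε : ℤ),
    g.continuous.mul ((f.1.continuous.comp θ.continuous).zpow₀ _ fun y => Or.inl (hpos _).ne')⟩
  have hG : ∀ y, 0 < G y := fun y => mul_pos (hg y) (zpow_pos (hpos _) _)
  have hlog : toQuot (logMap g hg) + signPullback ε θ (logQuot f) = toQuot (logMap G hG) := by
    rw [logQuot, signPullback_toQuot, ← map_add]
    congr 1
    ext y
    change Real.log (g y) + ((ε : ℤ) : ℝ) * Real.log (f.1 (θ y)) =
      Real.log (g y * f.1 (θ y) ^ (ε : ℤ))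
    rw [Real.log_mul (hg y).ne' (zpow_pos (hpos _) _).ne', Real.log_zpow]
  rw [hlog, logQuot_eq_iff hμ₂]
  rfl

variable [CompactSpace K₁] [BorelSpace K₁] [IsFiniteMeasure μ₁]
  [CompactSpace K₂] [BorelSpace K₂] [IsFiniteMeasure μ₂]

theorem isHilbertIsometry_iff (hμ₁ : IsStrictlyPositive μ₁) (hμ₂ : IsStrictlyPositive μ₂)
    (h : openSimplex μ₁ → openSimplex μ₂) :
    IsHilbertIsometry h ↔
      ∀ f f', ‖logQuot (h f) - logQuot (h f')‖ = ‖logQuot f - logQuot f'‖ := by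
  refine forall₂_congr fun f f' => ?_
  rw [hilbertDist_eq_norm_logQuot_sub hμ₁, hilbertDist_eq_norm_logQuot_sub hμ₂]
  exact mul_right_inj' two_ne_zero

theorem isHilbertIsometry_of_logQuot_eq [Nonempty K₁] [Nonempty K₂]
    (hμ₁ : IsStrictlyPositive μ₁) (hμ₂ : IsStrictlyPositive μ₂)
    {h : openSimplex μ₁ → openSimplex μ₂} {ε : ℤˣ} {θ : K₂ ≃ₜ K₁} {b : QuotConst K₂}
    (hh : ∀ f, logQuot (h f) = b + signPullback ε θ (logQuot f)) : IsHilbertIsometry h := by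
  rw [isHilbertIsometry_iff hμ₁ hμ₂]
  intro f f'
  rw [hh, hh, add_sub_add_left_eq_sub, ← map_sub, norm_signPullback]

variable [T2Space K₁] [T2Space K₂]

/-- Surjective isometries are affine signed composition operators in logarithmic coordinates. -/
theorem exists_logQuot_eq [Nonempty K₁] [Nonempty K₂]
    (hμ₁ : IsStrictlyPositive μ₁) (hμ₂ : IsStrictlyPositive μ₂)
    {h : openSimplex μ₁ → openSimplex μ₂} (hiso : IsHilbertIsometry h)
    (hsurj : Function.Surjective h) :
    ∃ (ε : ℤˣ) (θ : K₂ ≃ₜ K₁) (b : QuotConst K₂),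
      ∀ f, logQuot (h f) = b + signPullback ε θ (logQuot f) := by
  rw [isHilbertIsometry_iff hμ₁ hμ₂] at hiso
  let e := Equiv.ofBijective (logQuot (μ := μ₁)) ⟨logQuot_injective hμ₁, logQuot_surjective hμ₁⟩
  have he : ∀ a, logQuot (e.symm a) = a := e.apply_symm_apply
  let H : QuotConst K₁ → QuotConst K₂ := fun a => logQuot (h (e.symm a))
  have hH : Isometry H := Isometry.of_dist_eq fun a b => by
    rw [dist_eq_norm_sub, dist_eq_norm_sub]
    exact (hiso _ _).trans (by rw [he, he])
  have hHs : Function.Surjective H :=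
    (logQuot_surjective hμ₂).comp (hsurj.comp e.symm.surjective)
  let E : QuotConst K₁ ≃ᵢ QuotConst K₂ := ⟨Equiv.ofBijective H ⟨hH.injective, hHs⟩, hH⟩
  -- Mazur–Ulam: `E` minus its value at 0 is linear.
  obtain ⟨ε, θ, hT⟩ := exists_sign_homeomorph E.toRealLinearIsometryEquiv
  refine ⟨ε, θ, H 0, fun f => ?_⟩
  obtain ⟨k, hk⟩ := toQuot_surjective (logQuot f)
  have h1 : H (logQuot f) = logQuot (h f) := congrArg (fun z => logQuot (h z)) (e.symm_apply_apply f)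
  have h2 := hT k
  rw [← signPullback_toQuot, hk, IsometryEquiv.toRealLinearIsometryEquiv_apply] at h2
  rw [← h1, ← h2]
  exact (add_sub_cancel (H 0) (H (logQuot f))).symm

theorem isHilbertIsometry_and_surjective_iff
    (hμ₁ : IsStrictlyPositive μ₁) (hμ₂ : IsStrictlyPositive μ₂)
    (h : openSimplex μ₁ → openSimplex μ₂) :
    (IsHilbertIsometry h ∧ Function.Surjective h) ↔
      ∃ (ε : ℤ) (θ : K₂ ≃ₜ K₁) (g : C(K₂, ℝ)),
        (ε = 1 ∨ ε = -1) ∧ (∀ x, 0 < g x) ∧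
        ∀ (f : openSimplex μ₁) (x : K₂),
          (h f : C(K₂, ℝ)) x =
            g x * ((f : C(K₁, ℝ)) (θ x)) ^ ε /
              ∫ y, g y * ((f : C(K₁, ℝ)) (θ y)) ^ ε ∂μ₂ := by
  -- Over an empty space every integral is 0, so the open simplex is empty.
  rcases isEmpty_or_nonempty K₁ with hK₁ | hK₁
  · have hS₁ : IsEmpty (openSimplex μ₁) := by
      rwa [← not_nonempty_iff, nonempty_openSimplex_iff hμ₁, not_nonempty_iff]
    constructor
    · rintro ⟨-, hs⟩
      have hK₂ : IsEmpty K₂ := by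
        rw [← not_nonempty_iff, ← nonempty_openSimplex_iff hμ₂, not_nonempty_iff]
        exact ⟨fun k => hS₁.elim (hs k).choose⟩
      exact ⟨1, Homeomorph.empty, 1, Or.inl rfl, fun x => hK₂.elim x, fun f => hS₁.elim f⟩
    · rintro ⟨-, θ, -⟩
      have hK₂ : IsEmpty K₂ := θ.toEquiv.isEmpty
      have hS₂ : IsEmpty (openSimplex μ₂) := by
        rwa [← not_nonempty_iff, nonempty_openSimplex_iff hμ₂, not_nonempty_iff]
      exact ⟨fun f => hS₁.elim f, fun k => hS₂.elim k⟩
  have hK₂ : Nonempty K₂ :=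
    (nonempty_openSimplex_iff hμ₂).1 (((nonempty_openSimplex_iff hμ₁).2 hK₁).map h)
  constructor
  · rintro ⟨hiso, hsurj⟩
    obtain ⟨ε, θ, b, hh⟩ := exists_logQuot_eq hμ₁ hμ₂ hiso hsurj
    obtain ⟨k, rfl⟩ := toQuot_surjective b
    obtain ⟨g, hg, rfl⟩ := exists_logMap_eq k
    refine ⟨ε, θ, g, ?_, hg, fun f => (eq_weighted_comp_iff hμ₂ ε θ g hg f (h f)).2 (hh f)⟩
    exact (Int.units_eq_one_or ε).imp (by rintro rfl; rfl) (by rintro rfl; rfl)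
  · rintro ⟨n, θ, g, hn, hg, hh⟩
    obtain ⟨ε, rfl⟩ : ∃ ε : ℤˣ, (ε : ℤ) = n :=
      hn.elim (fun h => ⟨1, h.symm⟩) fun h => ⟨-1, h.symm⟩
    have hh' := fun f => (eq_weighted_comp_iff hμ₂ ε θ g hg f (h f)).1 (hh f)
    refine ⟨isHilbertIsometry_of_logQuot_eq hμ₁ hμ₂ hh', fun k => ?_⟩
    obtain ⟨f, hf⟩ := logQuot_surjective hμ₁
      (signPullback ε θ.symm (logQuot k - toQuot (logMap g hg)))
    refine ⟨f, logQuot_injective hμ₂ ?_⟩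
    rw [hh', hf, signPullback_signPullback_symm, add_sub_cancel]

end Isometries

/-! ### The isometry group as a semidirect product. -/

section IsometryGroup

variable {K : Type*} [TopologicalSpace K]

variable (K) in
/-- The semidirect product acts on `C(K)` modulo constants by affine maps. -/
noncomputable def affinePerm :
    (Multiplicative (QuotConst K) ⋊[signHomeoAction K] (ℤˣ × (K ≃ₜ K))) →*
      Equiv.Perm (QuotConst K) where
  toFun s :=
    { toFun := fun b => s.left.toAdd + signCompQuot s.right b
      invFun := fun b => signCompQuot s.right⁻¹ (b - s.left.toAdd)
      left_inv := fun b => by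
        beta_reduce
        rw [add_sub_cancel_left, ← signCompQuot_mul, inv_mul_cancel, signCompQuot_one]
      right_inv := fun b => by
        beta_reduce
        rw [← signCompQuot_mul, mul_inv_cancel, signCompQuot_one, add_sub_cancel] }
  map_one' := by
    ext b
    change (0 : QuotConst K) + signCompQuot 1 b = b
    rw [zero_add, signCompQuot_one]
  map_mul' s t := by
    ext b
    change s.left.toAdd + signCompQuot s.right t.left.toAdd + signCompQuot (s.right * t.right) b =
      s.left.toAdd + signCompQuot s.right (t.left.toAdd + signCompQuot t.right b)
    rw [map_add, signCompQuot_mul, add_assoc]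

variable [CompactSpace K] [T2Space K]

theorem evalDiff_injective {u v x y : K} (huv : u ≠ v)
    (h : ∀ a, evalDiff u v a = evalDiff x y a) : u = x ∧ v = y := by
  classical
  have key : ∀ z : K, ((if u = z then 1 else 0) - (if v = z then 1 else 0) : ℝ) =
      (if x = z then 1 else 0) - (if y = z then 1 else 0) := by
    intro z
    obtain ⟨g, hg⟩ := exists_continuousMap_eq_ite {u, v, x, y} z
    simpa only [evalDiff_toQuot, hg, Finset.mem_insert, Finset.mem_singleton, true_or, or_true]
      using h (toQuot g)
  have hu := key u
  have hv := key v
  grind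

/-- The action of `C₂ × Homeo(K)` is faithful if `K` has at least three points. -/
theorem eq_one_of_signCompQuot_eq (hK : 3 ≤ ENat.card K) {p : ℤˣ × (K ≃ₜ K)}
    (hp : ∀ b, signCompQuot p b = b) : p = 1 := by
  obtain ⟨ε, θ⟩ := p
  have h : ∀ u v b, ((ε : ℤ) : ℝ) * evalDiff (θ.symm u) (θ.symm v) b = evalDiff u v b := by
    intro u v b
    rw [← evalDiff_signPullback]
    exact congrArg (evalDiff u v) ((signCompQuot_eq (ε, θ) b).symm.trans (hp b))
  rcases Int.units_eq_one_or ε with rfl | rfl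
  · refine Prod.ext rfl ?_
    ext u
    obtain ⟨v, hv, -⟩ := ENat.exists_ne_ne_of_three_le hK u u
    have := (evalDiff_injective hv.symm fun a => by
      simpa using (h u v a).symm : u = θ.symm u ∧ v = θ.symm v).1
    exact θ.symm_apply_eq.1 this.symm |>.symm
  · exfalso
    -- With sign `-1`, `θ.symm` would send each point to every other point, which two points allow
    -- and three do not.
    have hsw : ∀ u v, u ≠ v → u = θ.symm v := fun u v huv =>
      (evalDiff_injective huv fun a => by
        rw [evalDiff_swap (θ.symm v)]
        simpa using (h u v a).symm : u = θ.symm v ∧ v = θ.symm u).1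
    have hne : Nonempty K := by
      rw [← ENat.one_le_card_iff_nonempty]
      exact le_trans (by norm_num) hK
    obtain ⟨u⟩ := hne
    obtain ⟨v, hv, -⟩ := ENat.exists_ne_ne_of_three_le hK u u
    obtain ⟨w, hwu, hwv⟩ := ENat.exists_ne_ne_of_three_le hK u v
    exact hwv (θ.symm.injective ((hsw u w hwu.symm).symm.trans (hsw u v hv.symm)))

theorem affinePerm_injective (hK : 3 ≤ ENat.card K) : Function.Injective (affinePerm K) := by
  rw [injective_iff_map_eq_one]
  intro s hs
  have h : ∀ b, s.left.toAdd + signCompQuot s.right b = b := fun b => Equiv.congr_fun hs b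
  have h0 : s.left.toAdd = 0 := by simpa using h 0
  refine SemidirectProduct.ext h0 (eq_one_of_signCompQuot_eq hK fun b => ?_)
  simpa [h0] using h b

variable [MeasurableSpace K] [BorelSpace K] {μ : Measure K} [IsFiniteMeasure μ]

theorem nonempty_isometryGroup_mulEquiv (hμ : IsStrictlyPositive μ) (hK : 3 ≤ ENat.card K) :
    Nonempty (isometryGroup (openSimplex μ) ≃*
      (Multiplicative (QuotConst K) ⋊[signHomeoAction K] (ℤˣ × (K ≃ₜ K)))) := by
  have hne : Nonempty K := by
    rw [← ENat.one_le_card_iff_nonempty]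
    exact le_trans (by norm_num) hK
  let e := Equiv.ofBijective (logQuot (μ := μ)) ⟨logQuot_injective hμ, logQuot_surjective hμ⟩
  have he : ∀ a, logQuot (e.symm a) = a := e.apply_symm_apply
  -- The affine action, conjugated by `logQuot` into permutations of the simplex.
  let Ψ := (e.symm.permCongrHom.toMonoidHom).comp (affinePerm K)
  have hΨ : ∀ s f, logQuot (Ψ s f) = s.left.toAdd +
      signPullback s.right.1 s.right.2.symm (logQuot f) := by
    intro s f
    rw [← signCompQuot_eq]
    exact he _
  have hmem : ∀ s, Ψ s ∈ isometryGroup (openSimplex μ) := fun s =>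
    isHilbertIsometry_of_logQuot_eq hμ hμ (hΨ s)
  refine ⟨(MulEquiv.ofBijective (Ψ.codRestrict _ hmem) ⟨?_, ?_⟩).symm⟩
  · intro s t hst
    exact affinePerm_injective hK (e.symm.permCongrHom.injective (congrArg Subtype.val hst))
  · rintro ⟨k, hk⟩
    obtain ⟨ε, θ, b, h⟩ := exists_logQuot_eq hμ hμ hk k.surjective
    -- The inverse appears because the action composes with `θ⁻¹`, while `signPullback` composes
    -- with `θ`.
    refine ⟨⟨Multiplicative.ofAdd b, (ε, θ.symm)⟩, Subtype.ext (Equiv.ext fun f => ?_)⟩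
    refine logQuot_injective hμ ((hΨ _ f).trans ?_)
    exact (h f).symm

end IsometryGroup

end HilbertGeometry

theorem theorem1p3
    {K₁ K₂ K : Type*}
    [TopologicalSpace K₁] [CompactSpace K₁] [T2Space K₁] [MeasurableSpace K₁] [BorelSpace K₁]
    [TopologicalSpace K₂] [CompactSpace K₂] [T2Space K₂] [MeasurableSpace K₂] [BorelSpace K₂]
    [TopologicalSpace K] [CompactSpace K] [T2Space K] [MeasurableSpace K] [BorelSpace K]
    (μ₁ : Measure K₁) [IsFiniteMeasure μ₁] (hμ₁ : HilbertGeometry.IsStrictlyPositive μ₁)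
    (μ₂ : Measure K₂) [IsFiniteMeasure μ₂] (hμ₂ : HilbertGeometry.IsStrictlyPositive μ₂)
    (μ : Measure K) [IsFiniteMeasure μ] (hμ : HilbertGeometry.IsStrictlyPositive μ) :
    (∀ h : HilbertGeometry.openSimplex μ₁ → HilbertGeometry.openSimplex μ₂,
      (HilbertGeometry.IsHilbertIsometry h ∧ Function.Surjective h) ↔
        ∃ (ε : ℤ) (θ : K₂ ≃ₜ K₁) (g : C(K₂, ℝ)),
          (ε = 1 ∨ ε = -1) ∧ (∀ x, 0 < g x) ∧
          ∀ (f : HilbertGeometry.openSimplex μ₁) (x : K₂),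
            (h f : C(K₂, ℝ)) x =
              g x * ((f : C(K₁, ℝ)) (θ x)) ^ ε /
                ∫ y, g y * ((f : C(K₁, ℝ)) (θ y)) ^ ε ∂μ₂) ∧
    (3 ≤ ENat.card K →
      Nonempty (HilbertGeometry.isometryGroup (HilbertGeometry.openSimplex μ) ≃*
        (Multiplicative (HilbertGeometry.QuotConst K) ⋊[HilbertGeometry.signHomeoAction K]
          (ℤˣ × (K ≃ₜ K))))) :=
  ⟨HilbertGeometry.isHilbertIsometry_and_surjective_iff hμ₁ hμ₂,
    HilbertGeometry.nonempty_isometryGroup_mulEquiv hμ⟩
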